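/- Let $\mathcal{O}$ be a one-dimensional noetherian domain with field of fractions $K$, and let $\tilde{\mathcal{O}}$ be its normalization, i.e. the integral closure of $\mathcal{O}$ in $K$. Assume that $\tilde{\mathcal{O}}$ is finitely generated as an $\mathcal{O}$-module. Let $\mathcal{I}(\mathcal{O})$ be the multiplicative group of invertible fractional ideals of $\mathcal{O}$, and let $\mathrm{Div}(\mathcal{O})$ be the free abelian group on the set of maximal ideals of $\mathcal{O}$. For a maximal ideal $\mathfrak{p}$ of $\mathcal{O}$ let $\mathcal{O}_\mathfrak{p}$ be the localization of $\mathcal{O}$ at $\mathfrak{p}$, and let $\mathrm{ord}_\mathfrak{p}\colon K^*\to\mathbb{Z}$ be the homomorphism $$\mathrm{ord}_\mathfrak{p}(a/b)=\mathrm{length}_{\mathcal{O}_\mathfrak{p}}(\mathcal{O}_\mathfrak{p}/a\mathcal{O}_\mathfrak{p})-\mathrm{length}_{\mathcal{O}_\mathfrak{p}}(\mathcal{O}_\mathfrak{p}/b\mathcal{O}_\mathfrak{p})\qquad(a,b\in\mathcal{O}\setminus\{0\}).$$ For $\mathfrak{a}\in\mathcal{I}(\mathcal{O})$ and each $\mathfrak{p}$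 there is $a_\mathfrak{p}\in K^*$ with $\mathfrak{a}\mathcal{O}_\mathfrak{p}=a_\mathfrak{p}\mathcal{O}_\mathfrak{p}$, and $$\mathrm{div}_\mathcal{O}\colon\mathcal{I}(\mathcal{O})\to\mathrm{Div}(\mathcal{O}),\qquad \mathfrak{a}\mapsto\sum_{\mathfrak{p}}\mathrm{ord}_\mathfrak{p}(a_\mathfrak{p})\,\mathfrak{p}$$ is a well-defined group homomorphism. Theorem 5.4. The homomorphism $\mathrm{div}_\mathcal{O}\colon\mathcal{I}(\mathcal{O})\to\mathrm{Div}(\mathcal{O})$ is injective if and only if $\mathcal{O}=\tilde{\mathcal{O}}$. -/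

import Mathlib

open scoped nonZeroDivisors

namespace OrderDiv

section Local

variable {O : Type*} [CommRing O] [IsDomain O]
variable (K : Type*) [Field K] [Algebra O K] [IsFractionRing O K]

/-- The localization `O_p` of the domain `O` at the maximal ideal `p`, realised as the subring
`{a / s | a ∈ O, s ∈ O ∖ p}` of the field of fractions `K`. -/
noncomputable abbrev localRing (p : MaximalSpectrum O) : Subalgebra O K :=
  Localization.subalgebra.ofField K p.asIdeal.primeCompl p.asIdeal.primeCompl_le_nonZeroDivisors

instance isLocalization_localRing (p : MaximalSpectrum O) :
    IsLocalization.AtPrime (localRing K p) p.asIdeal :=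
  Localization.subalgebra.isLocalization_ofField K p.asIdeal.primeCompl
    p.asIdeal.primeCompl_le_nonZeroDivisors

instance isNoetherianRing_localRing [IsNoetherianRing O] (p : MaximalSpectrum O) :
    IsNoetherianRing (localRing K p) :=
  IsLocalization.isNoetherianRing p.asIdeal.primeCompl _ inferInstance

instance krullDimLE_localRing [Ring.KrullDimLE 1 O] (p : MaximalSpectrum O) :
    Ring.KrullDimLE 1 (localRing K p) := by
  rw [Ring.KrullDimLE, Order.krullDimLE_iff]
  have h := IsLocalization.AtPrime.ringKrullDim_eq_height p.asIdeal (localRing K p)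
  have h2 : (p.asIdeal.height : WithBot ℕ∞) ≤ ringKrullDim O :=
    Ideal.height_le_ringKrullDim_of_ne_top p.isMaximal.ne_top
  have h3 : ringKrullDim O ≤ 1 := Order.KrullDimLE.krullDim_le
  exact h.le.trans (h2.trans h3)

/-- The homomorphism `ord_p : Kˣ → ℤ` (written multiplicatively), sending `a / b` to
`length (O_p / a O_p) - length (O_p / b O_p)`, where the lengths are those of `O_p`-modules. -/
noncomputable def ordAt [IsNoetherianRing O] [Ring.KrullDimLE 1 O] (p : MaximalSpectrum O) :
    Kˣ →* Multiplicative ℤ :=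
  (WithZero.unitsWithZeroEquiv (α := Multiplicative ℤ)).toMonoidHom.comp
    (Units.map (Ring.ordFrac (localRing K p) : K →*₀ WithZero (Multiplicative ℤ)).toMonoidHom)

variable {K}

/-- The localization `I_p = I O_p` of a fractional ideal `I` of `O`, as an `O_p`-submodule
of `K`. -/
noncomputable def localIdeal (p : MaximalSpectrum O) (I : FractionalIdeal O⁰ K) :
    Submodule (localRing K p) K :=
  Submodule.span (localRing K p) (I : Set K)

theorem ordAt_eq_of_isUnit [IsNoetherianRing O] [Ring.KrullDimLE 1 O] (p : MaximalSpectrum O)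
    (x : Kˣ) (u : (localRing K p)ˣ) (hu : (x : K) = ((u : localRing K p) : K)) :
    ordAt K p x = 1 := by
  have h0 : (u : localRing K p) ≠ 0 := u.ne_zero
  have h1 : Ring.ordFrac (localRing K p) (x : K) = 1 := by
    have h := Ring.ordFrac_eq_ord (localRing K p) (K := K) h0
    rw [Ring.ordMonoidWithZeroHom_eq_coe _ (mem_nonZeroDivisors_of_ne_zero h0) (n := 0)
      (by simp)] at h
    rw [hu]
    exact h
  have h2 : Units.map (Ring.ordFrac (localRing K p) :
      K →*₀ WithZero (Multiplicative ℤ)).toMonoidHom x = 1 := Units.ext h1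
  unfold ordAt
  rw [MonoidHom.comp_apply, h2, map_one]

theorem ordAt_eq_of_span_eq [IsNoetherianRing O] [Ring.KrullDimLE 1 O] (p : MaximalSpectrum O)
    (x y : Kˣ) (h : Submodule.span (localRing K p) {(x : K)} =
      Submodule.span (localRing K p) {(y : K)}) : ordAt K p x = ordAt K p y := by
  obtain ⟨u, hu⟩ := Submodule.span_singleton_eq_span_singleton.mp h
  have : ordAt K p (y * x⁻¹) = 1 := by
    refine ordAt_eq_of_isUnit p _ u ?_
    rw [Units.val_mul, ← hu]
    have : (u • (x : K)) = ((u : localRing K p) : K) * (x : K) := rfl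
    rw [this, mul_assoc, Units.mul_inv, mul_one]
  rw [map_mul, map_inv, mul_inv_eq_one] at this
  exact this.symm

theorem inv_mem_localRing (p : MaximalSpectrum O) {s : O} (hs : s ∉ p.asIdeal) :
    (algebraMap O K s)⁻¹ ∈ localRing K p :=
  ⟨1, s, hs, by simp⟩

/-- An invertible fractional ideal of `O` becomes principal in `O_p`. -/
theorem exists_localIdeal_eq (p : MaximalSpectrum O) (I : (FractionalIdeal O⁰ K)ˣ) :
    ∃ x : Kˣ, localIdeal p (I : FractionalIdeal O⁰ K) =
      Submodule.span (localRing K p) {(x : K)} := by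
  obtain ⟨a, ha, b, hb, c, hc, hab⟩ : ∃ a ∈ (I : FractionalIdeal O⁰ K),
      ∃ b ∈ ((I⁻¹ : (FractionalIdeal O⁰ K)ˣ) : FractionalIdeal O⁰ K),
      ∃ c : O, c ∉ p.asIdeal ∧ algebraMap O K c = a * b := by
    by_contra! h
    have hle : (I : FractionalIdeal O⁰ K) * ((I⁻¹ : (FractionalIdeal O⁰ K)ˣ) :
        FractionalIdeal O⁰ K) ≤ (p.asIdeal : FractionalIdeal O⁰ K) := by
      rw [FractionalIdeal.mul_le]
      intro i hi j hj
      have hij := FractionalIdeal.mul_mem_mul hi hj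
      rw [Units.mul_inv, FractionalIdeal.mem_one_iff] at hij
      obtain ⟨c, hc⟩ := hij
      rw [FractionalIdeal.mem_coeIdeal]
      refine ⟨c, ?_, hc⟩
      by_contra hcp
      exact h i hi j hj c hcp hc
    rw [Units.mul_inv, ← FractionalIdeal.coeIdeal_top, FractionalIdeal.coeIdeal_le_coeIdeal] at hle
    exact p.isMaximal.ne_top (top_le_iff.mp hle)
  have hc0 : algebraMap O K c ≠ 0 := by
    intro h0
    rw [map_eq_zero_iff _ (IsFractionRing.injective O K)] at h0
    exact hc (h0 ▸ p.asIdeal.zero_mem)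
  have ha0 : a ≠ 0 := fun h => hc0 (by rw [hab, h, zero_mul])
  have hb0 : b ≠ 0 := fun h => hc0 (by rw [hab, h, mul_zero])
  refine ⟨Units.mk0 a ha0, le_antisymm ?_ ?_⟩
  · refine Submodule.span_le.mpr fun x hx => ?_
    have hxb := FractionalIdeal.mul_mem_mul hx hb
    rw [Units.mul_inv, FractionalIdeal.mem_one_iff] at hxb
    obtain ⟨d, hd⟩ := hxb
    refine Submodule.mem_span_singleton.mpr
      ⟨algebraMap O (localRing K p) d * ⟨_, inv_mem_localRing p hc⟩, ?_⟩
    change (algebraMap O K d * (algebraMap O K c)⁻¹) * a = x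
    rw [hd, hab]
    field_simp
  · refine Submodule.span_mono ?_
    simpa using ha

theorem localIdeal_mul (p : MaximalSpectrum O) (I J : FractionalIdeal O⁰ K) :
    localIdeal p (I * J) = localIdeal p I * localIdeal p J := by
  unfold localIdeal
  rw [Submodule.span_mul_span]
  refine le_antisymm (Submodule.span_le.mpr fun x hx => ?_) (Submodule.span_mono ?_)
  · refine FractionalIdeal.mul_induction_on hx (fun i hi j hj => ?_) fun a b ha hb => ?_
    · exact Submodule.subset_span (Set.mul_mem_mul hi hj)
    · exact add_mem ha hb
  · rintro _ ⟨i, hi, j, hj, rfl⟩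
    exact FractionalIdeal.mul_mem_mul hi hj

theorem localIdeal_le_one (p : MaximalSpectrum O) (I : FractionalIdeal O⁰ K) (d : O)
    (hd : d ∉ p.asIdeal) (h : ∀ x ∈ I, IsLocalization.IsInteger O (d • x)) :
    localIdeal p I ≤ 1 := by
  refine Submodule.span_le.mpr fun x hx => ?_
  obtain ⟨c, hc⟩ := h x hx
  refine Submodule.mem_one.mpr
    ⟨algebraMap O (localRing K p) c * ⟨_, inv_mem_localRing p hd⟩, ?_⟩
  change algebraMap O K c * (algebraMap O K d)⁻¹ = x
  have hd0 : algebraMap O K d ≠ 0 := by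
    intro h0
    rw [map_eq_zero_iff _ (IsFractionRing.injective O K)] at h0
    exact hd (h0 ▸ p.asIdeal.zero_mem)
  rw [hc, Algebra.smul_def]
  field_simp

variable [IsNoetherianRing O] [Ring.KrullDimLE 1 O]

/-- `ord_p (x_p)`, where `x_p` is any generator of the localization `I_p`. -/
noncomputable def ordIdeal (p : MaximalSpectrum O) (I : (FractionalIdeal O⁰ K)ˣ) : ℤ :=
  (ordAt K p (exists_localIdeal_eq p I).choose).toAdd

/-- The value `ordIdeal p I` does not depend on the chosen generator of `I_p`. -/
theorem ordIdeal_eq (p : MaximalSpectrum O) (I : (FractionalIdeal O⁰ K)ˣ) (x : Kˣ)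
    (hx : localIdeal p (I : FractionalIdeal O⁰ K) = Submodule.span (localRing K p) {(x : K)}) :
    ordIdeal p I = (ordAt K p x).toAdd := by
  unfold ordIdeal
  rw [ordAt_eq_of_span_eq p _ x ((exists_localIdeal_eq p I).choose_spec.symm.trans hx)]

theorem ordIdeal_mul (p : MaximalSpectrum O) (I J : (FractionalIdeal O⁰ K)ˣ) :
    ordIdeal p (I * J) = ordIdeal p I + ordIdeal p J := by
  obtain ⟨x, hx⟩ := exists_localIdeal_eq p I
  obtain ⟨y, hy⟩ := exists_localIdeal_eq p J
  rw [ordIdeal_eq p I x hx, ordIdeal_eq p J y hy, ordIdeal_eq p (I * J) (x * y), map_mul, toAdd_mul]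
  rw [Units.val_mul, localIdeal_mul, hx, hy, Submodule.span_mul_span, Set.singleton_mul_singleton,
    Units.val_mul]

theorem ordIdeal_one (p : MaximalSpectrum O) :
    ordIdeal p (1 : (FractionalIdeal O⁰ K)ˣ) = 0 := by
  have := ordIdeal_mul p (1 : (FractionalIdeal O⁰ K)ˣ) 1
  rw [mul_one] at this
  omega

/-- A nonzero element of `O` lies in only finitely many maximal ideals. -/
theorem finite_maximal_of_mem {d : O} (hd : d ≠ 0) :
    {p : MaximalSpectrum O | d ∈ p.asIdeal}.Finite := by
  have h1 := isFiniteLength_quotient_span_singleton O (mem_nonZeroDivisors_of_ne_zero hd)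
  rw [isFiniteLength_iff_isNoetherian_isArtinian] at h1
  have : IsArtinianRing (O ⧸ Ideal.span {d}) := isArtinian_of_tower O h1.2
  have h2 : (PrimeSpectrum.zeroLocus {d} : Set (PrimeSpectrum O)).Finite := by
    have h3 := range_comap_of_surjective _ (Ideal.Quotient.mk (Ideal.span {d}))
      Ideal.Quotient.mk_surjective
    rw [Ideal.mk_ker, PrimeSpectrum.zeroLocus_span] at h3
    rw [← h3]
    exact Set.finite_range _
  refine Set.Finite.of_finite_image (f := MaximalSpectrum.toPrimeSpectrum) (h2.subset ?_)
    (MaximalSpectrum.toPrimeSpectrum_injective.injOn)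
  rintro _ ⟨p, hp, rfl⟩
  exact (PrimeSpectrum.mem_zeroLocus _ _).mpr (Set.singleton_subset_iff.mpr hp)

theorem ordIdeal_finite_support (I : (FractionalIdeal O⁰ K)ˣ) :
    (Function.support fun p : MaximalSpectrum O => ordIdeal p I).Finite := by
  obtain ⟨d, hd, hdI⟩ := (I : FractionalIdeal O⁰ K).isFractional
  obtain ⟨e, he, heI⟩ :=
    ((I⁻¹ : (FractionalIdeal O⁰ K)ˣ) : FractionalIdeal O⁰ K).isFractional
  refine ((finite_maximal_of_mem (nonZeroDivisors.ne_zero hd)).union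
    (finite_maximal_of_mem (nonZeroDivisors.ne_zero he))).subset fun p hp => ?_
  by_contra hpn
  simp only [Set.mem_union, Set.mem_ofPred_eq, not_or] at hpn
  have h1 := localIdeal_le_one p _ d hpn.1 hdI
  have h2 := localIdeal_le_one p _ e hpn.2 heI
  have h1' : localIdeal p (1 : FractionalIdeal O⁰ K) = 1 := by
    refine le_antisymm (localIdeal_le_one p _ 1 (fun h => p.isMaximal.ne_top
      ((Ideal.eq_top_iff_one _).mpr h)) fun x hx => ?_) ?_
    · rw [one_smul]
      exact (FractionalIdeal.mem_one_iff _).mp hx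
    · rw [Submodule.one_le]
      exact Submodule.subset_span (FractionalIdeal.one_mem_one _)
  have h3 : localIdeal p (I : FractionalIdeal O⁰ K) = 1 := by
    refine le_antisymm h1 ?_
    calc (1 : Submodule (localRing K p) K)
        = localIdeal p (I : FractionalIdeal O⁰ K) * localIdeal p
          ((I⁻¹ : (FractionalIdeal O⁰ K)ˣ) : FractionalIdeal O⁰ K) := by
          rw [← localIdeal_mul, Units.mul_inv, h1']
      _ ≤ localIdeal p (I : FractionalIdeal O⁰ K) * 1 := mul_le_mul_right h2 _
      _ = _ := mul_one _
  refine hp ?_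
  change ordIdeal p I = 0
  rw [ordIdeal_eq p I 1 (by rw [h3, Submodule.one_eq_span, Units.val_one]), map_one, toAdd_one]

end Local

/-- The group of divisors `Div(O)`: the free abelian group on the maximal ideals of `O`. -/
abbrev Divisor (O : Type*) [CommRing O] : Type _ := MaximalSpectrum O →₀ ℤ

/-- The canonical homomorphism `div_O : I(O) → Div(O)`, `I ↦ ∑_p ord_p(x_p) p` with
`I_p = x_p O_p`, from the group of invertible fractional ideals of `O` to the group of divisors
(which is written multiplicatively). -/
noncomputable def divisorHom (O : Type*) [CommRing O] [IsDomain O] [IsNoetherianRing O]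
    [Ring.KrullDimLE 1 O] (K : Type*) [Field K] [Algebra O K] [IsFractionRing O K] :
    (FractionalIdeal O⁰ K)ˣ →* Multiplicative (Divisor O) where
  toFun I := Multiplicative.ofAdd
    (Finsupp.ofSupportFinite (fun p => ordIdeal p I) (ordIdeal_finite_support I))
  map_one' := by
    rw [← ofAdd_zero]
    congr 1
    ext p
    exact ordIdeal_one p
  map_mul' I J := by
    rw [← ofAdd_add]
    congr 1
    ext p
    exact ordIdeal_mul p I J

end OrderDiv

/-! Both directions reduce to one question: is the kernel of `ord_p` on `Kˣ` exactly the unit group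
of `O_p`?

If `O` is normal, it is Dedekind and each `O_p` is a discrete valuation ring. An element of order
zero is then a unit of `O_p`, so an ideal with trivial divisor is locally, hence globally, trivial.

Conversely, each nonzero `a` in `O` gives an invertible ideal equal to `a O_p` at `p` and trivial
elsewhere (`exists_localIdeal_eq_span`). If `ord_p (a / b) = 0`, the ideals of `a` and `b` have the
same divisor, so injectivity makes them equal and `a / b` is a unit of `O_p`
(`exists_unit_of_ordAt_eq_one`). Thus `Kˣ / O_pˣ` embeds in `ℤ` and is cyclic. This alone forces
`O_p` to be integrally closed (`mem_range_of_isIntegral_of_ker_le`), and `O` is the intersection of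
the `O_p`. -/

namespace OrderDiv

/-! ### Integral closedness from a cyclic value group -/

/-- If `a⁻¹` is integral over `A` for some `a` in `A`, then `a` is a unit of `A`. -/
theorem isUnit_of_isIntegral_inv {A K : Type*} [CommRing A] [Field K] [Algebra A K]
    [FaithfulSMul A K] {a : A} (ha : a ≠ 0) (h : IsIntegral A (algebraMap A K a)⁻¹) :
    IsUnit a := by
  have ha' : algebraMap A K a ≠ 0 := by simpa using ha
  let b : integralClosure A K := ⟨_, h⟩
  have hu : IsUnit (algebraMap A (integralClosure A K) a) := by
    refine IsUnit.of_mul_eq_one b (Subtype.ext ?_)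
    exact mul_inv_cancel₀ ha'
  -- Injective integral extensions reflect units, by lying over.
  have : IsLocalHom (algebraMap A (integralClosure A K)) :=
    (algebraMap_isIntegral_iff.mpr inferInstance).isLocalHom
      fun x y hxy => FaithfulSMul.algebraMap_injective A K (congrArg Subtype.val hxy)
  exact isUnit_of_map_unit _ _ hu

/-- If the kernel of a homomorphism `Kˣ → ℤ` consists of units of a subring `A` of `K` and `A` is
not a field, then `A` is integrally closed in `K`. -/
theorem mem_range_of_isIntegral_of_ker_le {A K : Type*} [CommRing A] [Field K] [Algebra A K]
    [FaithfulSMul A K] (f : Kˣ →* Multiplicative ℤ)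
    (hker : ∀ x : Kˣ, f x = 1 → ∃ u : Aˣ, algebraMap A K u = x)
    {a : A} (ha : ¬ IsUnit a) (ha0 : a ≠ 0)
    {x : K} (hx : IsIntegral A x) : x ∈ (algebraMap A K).range := by
  -- The image of `f` is a subgroup of `ℤ`, hence cyclic; with `hker`, the class of `ϖ` generates
  -- `Kˣ` modulo `Aˣ`.
  obtain ⟨⟨_, ϖ, rfl⟩, hgen⟩ := IsCyclic.exists_generator (α := f.range)
  have key : ∀ y : Kˣ, ∃ (n : ℤ) (u : Aˣ), (y : K) = algebraMap A K u * (ϖ : K) ^ n := by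
    intro y
    obtain ⟨n, hn⟩ := Subgroup.mem_zpowers_iff.mp (hgen ⟨f y, y, rfl⟩)
    have hn' : f ϖ ^ n = f y := congrArg Subtype.val hn
    obtain ⟨u, hu⟩ := hker (y * (ϖ ^ n)⁻¹) (by rw [map_mul, map_inv, map_zpow, hn']; simp)
    refine ⟨n, u, ?_⟩
    rw [hu, ← Units.val_zpow_eq_zpow_val, ← Units.val_mul, inv_mul_cancel_right]
  clear hgen
  -- after inverting the generator if necessary, `a` is a positive power of it
  obtain ⟨π, n, hn, v, hv, key⟩ : ∃ (π : Kˣ) (n : ℕ), 0 < n ∧ ∃ v : Aˣ,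
      algebraMap A K a = algebraMap A K v * (π : K) ^ n ∧
      ∀ y : Kˣ, ∃ (m : ℤ) (u : Aˣ), (y : K) = algebraMap A K u * (π : K) ^ m := by
    obtain ⟨n, v, hv⟩ := key (Units.mk0 (algebraMap A K a) (by simpa using ha0))
    rw [Units.val_mk0] at hv
    have hn0 : n ≠ 0 := by
      rintro rfl
      rw [zpow_zero, mul_one] at hv
      exact ha ((FaithfulSMul.algebraMap_injective A K hv) ▸ v.isUnit)
    rcases lt_or_gt_of_ne hn0 with h | h
    · refine ⟨ϖ⁻¹, n.natAbs, by omega, v, ?_, fun y => ?_⟩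
      · rw [hv, ← zpow_natCast, Units.val_inv_eq_inv_val, inv_zpow', show -(n.natAbs : ℤ) = n by omega]
      · obtain ⟨m, u, h⟩ := key y
        exact ⟨-m, u, by rw [h, Units.val_inv_eq_inv_val, inv_zpow', neg_neg]⟩
    · refine ⟨ϖ, n.natAbs, by omega, v, ?_, key⟩
      rw [hv, ← zpow_natCast, show (n.natAbs : ℤ) = n by omega]
  have hπ0 : (π : K) ≠ 0 := π.ne_zero
  have hπ : IsIntegral A (π : K) := by
    refine IsIntegral.of_pow hn ?_
    have : (π : K) ^ n = algebraMap A K (↑v⁻¹ * a) := by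
      rw [map_mul, hv, ← mul_assoc, ← map_mul]; simp
    rw [this]
    exact isIntegral_algebraMap
  have hπinv : ¬ IsIntegral A (π : K)⁻¹ := fun h => by
    refine ha (isUnit_of_isIntegral_inv (K := K) ha0 ?_)
    have : (algebraMap A K a)⁻¹ = algebraMap A K ↑v⁻¹ * (π : K)⁻¹ ^ n := by
      rw [hv, mul_inv, inv_pow]
      congr 1
      refine inv_eq_of_mul_eq_one_right ?_
      rw [← map_mul]; simp
    rw [this]
    exact isIntegral_algebraMap.mul (h.pow n)
  -- integral elements have nonnegative exponent
  have hnonneg : ∀ y : K, IsIntegral A y → y ≠ 0 →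
      ∃ (m : ℕ) (u : Aˣ), y = algebraMap A K u * (π : K) ^ m := by
    intro y hy hy0
    obtain ⟨m, u, hu⟩ := key (Units.mk0 y hy0)
    rw [Units.val_mk0] at hu
    rcases le_or_gt 0 m with hm | hm
    · exact ⟨m.toNat, u, by rw [hu, ← zpow_natCast, Int.toNat_of_nonneg hm]⟩
    · refine absurd ?_ hπinv
      have : (π : K)⁻¹ = algebraMap A K ↑u⁻¹ * y * (π : K) ^ (-m - 1).toNat := by
        have h1 : algebraMap A K ↑u⁻¹ * algebraMap A K u = 1 := by rw [← map_mul]; simp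
        rw [← zpow_natCast, Int.toNat_of_nonneg (by omega), hu, ← mul_assoc, h1, one_mul,
          ← zpow_add₀ hπ0, show m + (-m - 1) = -1 by ring, zpow_neg_one]
      rw [this]
      exact (isIntegral_algebraMap.mul hy).mul (hπ.pow _)
  -- The element `1 + π` is integral, so it is `u * π ^ m` with `m ≥ 0`. If `m = 0`, then `π = u -
  -- 1` lies in `A`; if `m > 0`, dividing by `π` makes `π⁻¹` integral, which is excluded.
  have hπA : (π : K) ∈ (algebraMap A K).range := by
    by_cases h0 : (1 + π : K) = 0
    · exact ⟨-1, by rw [map_neg, map_one]; linear_combination -h0⟩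
    obtain ⟨m, u, hu⟩ := hnonneg _ (isIntegral_one.add hπ) h0
    cases m with
    | zero => exact ⟨u - 1, by rw [map_sub, map_one]; linear_combination -hu⟩
    | succ m =>
      refine absurd ?_ hπinv
      have : (π : K)⁻¹ = algebraMap A K u * (π : K) ^ m - 1 := by
        field_simp
        linear_combination hu
      rw [this]
      exact (isIntegral_algebraMap.mul (hπ.pow _)).sub isIntegral_one
  by_cases h0 : x = 0
  · exact h0 ▸ zero_mem _
  obtain ⟨m, u, rfl⟩ := hnonneg x hx h0
  exact mul_mem ⟨_, rfl⟩ (pow_mem hπA m)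

/-! ### Elements of order zero in `O_p` -/

section Local

variable {O : Type*} [CommRing O] [IsDomain O] {K : Type*} [Field K] [Algebra O K]
  [IsFractionRing O K]

variable [IsNoetherianRing O] [Ring.KrullDimLE 1 O]

/-- An element of `O_p` of order zero is a unit of `O_p`. -/
theorem isUnit_of_ordAt_eq_one (p : MaximalSpectrum O) (x : Kˣ) (r : localRing K p)
    (hx : (x : K) = (r : K)) (h : ordAt K p x = 1) : IsUnit r := by
  have hr : r ≠ 0 := by
    rintro rfl
    exact x.ne_zero hx
  have hr' := mem_nonZeroDivisors_of_ne_zero hr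
  have h1 : Ring.ordFrac (localRing K p) (x : K) = 1 := by
    unfold ordAt at h
    rw [MonoidHom.comp_apply] at h
    have h2 := WithZero.unitsWithZeroEquiv.injective (h.trans (map_one _).symm)
    exact congrArg Units.val h2
  have h2 := Ring.ordFrac_eq_ord (localRing K p) (K := K) hr
  -- The length of `O_p / r O_p` is finite, so order zero means length zero, and the quotient
  -- vanishes.
  obtain ⟨n, hn⟩ := ENat.ne_top_iff_exists.mp (Ring.ord_ne_top hr')
  rw [Ring.ordMonoidWithZeroHom_eq_coe _ hr' hn.symm] at h2
  have h3 : ((Multiplicative.ofAdd (n : ℤ) : Multiplicative ℤ) : WithZero (Multiplicative ℤ)) = 1 :=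
    h2.symm.trans ((congrArg _ hx.symm).trans h1)
  have h4 : n = 0 := by
    have := WithZero.coe_injective (h3.trans WithZero.coe_one.symm)
    simpa using this
  rw [h4, Nat.cast_zero, Ring.ord, eq_comm, Module.length_eq_zero_iff,
    Submodule.Quotient.subsingleton_iff] at hn
  exact Ideal.span_singleton_eq_top.mp hn

end Local

/-! ### The part of a principal ideal at one maximal ideal -/

section Primary

variable {O : Type*} [CommRing O]

/-- The ideal of all `x` with `s x ∈ a O` for some `s ∉ p`, i.e. the preimage of `a O_p`. -/
def primaryPart (p : MaximalSpectrum O) (a : O) : Ideal O where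
  carrier := {x | ∃ s ∉ p.asIdeal, a ∣ s * x}
  zero_mem' := ⟨1, fun h => p.isMaximal.ne_top ((Ideal.eq_top_iff_one _).mpr h), by simp⟩
  add_mem' := by
    rintro x y ⟨s, hs, h⟩ ⟨t, ht, h'⟩
    refine ⟨s * t, fun hst => (p.isMaximal.isPrime.mem_or_mem hst).elim hs ht, ?_⟩
    have : s * t * (x + y) = t * (s * x) + s * (t * y) := by ring
    rw [this]
    exact dvd_add (h.mul_left _) (h'.mul_left _)
  smul_mem' := by
    rintro c x ⟨s, hs, h⟩
    refine ⟨s, hs, ?_⟩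
    rw [smul_eq_mul, mul_left_comm]
    exact h.mul_left _

theorem mem_primaryPart {p : MaximalSpectrum O} {a x : O} :
    x ∈ primaryPart p a ↔ ∃ s ∉ p.asIdeal, a ∣ s * x := Iff.rfl

theorem self_mem_primaryPart (p : MaximalSpectrum O) (a : O) : a ∈ primaryPart p a :=
  ⟨1, fun h => p.isMaximal.ne_top ((Ideal.eq_top_iff_one _).mpr h), by simp⟩

/-- A single element outside `p` multiplies `primaryPart p a` into `a O`. -/
theorem exists_forall_dvd_mul [IsNoetherianRing O] (p : MaximalSpectrum O) (a : O) :
    ∃ s ∉ p.asIdeal, ∀ x ∈ primaryPart p a, a ∣ s * x := by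
  obtain ⟨T, hT⟩ := IsNoetherian.noetherian (primaryPart p a)
  have hT' : ∀ x ∈ T, x ∈ primaryPart p a := fun x hx => hT ▸ Submodule.subset_span hx
  choose! s hs h using hT'
  -- The product of the multipliers of finitely many generators works for all of them, and avoids
  -- `p` by primality.
  refine ⟨∏ x ∈ T, s x, fun hmem => ?_, fun x hx => ?_⟩
  · obtain ⟨x, hx, hxs⟩ := (p.isMaximal.isPrime.prod_mem_iff).mp hmem
    exact hs x hx hxs
  · rw [← hT] at hx
    induction hx using Submodule.span_induction with
    | mem x hx =>
      exact (h x hx).trans (mul_dvd_mul_right (Finset.dvd_prod_of_mem s hx) x)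
    | zero => simp
    | add x y _ _ hx hy => rw [mul_add]; exact dvd_add hx hy
    | smul c x _ hx => rw [smul_eq_mul, mul_left_comm]; exact hx.mul_left _

variable [IsDomain O]

/-- In a domain of dimension at most one, `p` is the only maximal ideal that contains
`primaryPart p a`. -/
theorem eq_of_primaryPart_le [Ring.KrullDimLE 1 O] {p q : MaximalSpectrum O} {a : O} (ha : a ≠ 0)
    (h : primaryPart p a ≤ q.asIdeal) : q = p := by
  have hle : p.asIdeal ≤ q.asIdeal := by
    intro t ht
    by_contra htq
    -- a prime containing `a` and avoiding all `s * t ^ n` is strictly smaller than `p`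
    let S : Submonoid O := p.asIdeal.primeCompl ⊔ Submonoid.powers t
    have hdisj : Disjoint ((Ideal.span {a} : Ideal O) : Set O) S := by
      rw [Set.disjoint_left]
      intro x hx hxS
      obtain ⟨s, hs, _, ⟨n, rfl⟩, rfl⟩ := Submonoid.mem_sup.mp hxS
      have : t ^ n ∈ primaryPart p a := ⟨s, hs, Ideal.mem_span_singleton.mp hx⟩
      exact htq (q.isMaximal.isPrime.mem_of_pow_mem n (h this))
    obtain ⟨P, hP, hPa, hPS⟩ := Ideal.exists_le_prime_disjoint _ _ hdisj
    have hPp : P ≤ p.asIdeal := by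
      intro x hx
      by_contra hxp
      exact Set.disjoint_left.mp hPS hx
        ((le_sup_left : p.asIdeal.primeCompl ≤ S) hxp)
    have haP : a ∈ P := hPa (Ideal.mem_span_singleton_self a)
    have hP0 : P ≠ ⊥ := by
      rintro rfl
      exact ha (by simpa using haP)
    have hPmax : P.IsMaximal := hP.isMaximal_of_ne_bot hP0
    have hPeq := hPmax.eq_of_le p.isMaximal.ne_top hPp
    exact Set.disjoint_left.mp hPS (hPeq ▸ ht)
      ((le_sup_right : Submonoid.powers t ≤ S) (Submonoid.mem_powers t))
  exact MaximalSpectrum.ext (p.isMaximal.eq_of_le q.isMaximal.ne_top hle).symm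

/-- `primaryPart p a` is a factor of the principal ideal `a O`. -/
theorem exists_primaryPart_mul_eq [IsNoetherianRing O] [Ring.KrullDimLE 1 O]
    (p : MaximalSpectrum O) {a : O} (ha : a ≠ 0) :
    ∃ J : Ideal O, primaryPart p a * J = Ideal.span {a} := by
  obtain ⟨s, hs, h⟩ := exists_forall_dvd_mul p a
  -- The cofactor `(s, a)` works because `s` carries the primary part into `a O` and is coprime to
  -- it.
  refine ⟨Ideal.span {s, a}, ?_⟩
  have hcop : primaryPart p a ⊔ Ideal.span {s} = ⊤ := by
    by_contra hne
    obtain ⟨m, hm, hle⟩ := Ideal.exists_le_maximal _ hne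
    have := eq_of_primaryPart_le (q := ⟨m, hm⟩) ha (le_sup_left.trans hle)
    refine hs (this ▸ ?_)
    exact hle ((le_sup_right : Ideal.span {s} ≤ _) (Ideal.mem_span_singleton_self s))
  apply le_antisymm
  · rw [Ideal.mul_le]
    intro x hx y hy
    obtain ⟨b, c, rfl⟩ := Ideal.mem_span_pair.mp hy
    rw [Ideal.mem_span_singleton]
    have : x * (b * s + c * a) = b * (s * x) + a * (c * x) := by ring
    rw [this]
    exact dvd_add ((h x hx).mul_left _) (dvd_mul_right _ _)
  · rw [Ideal.span_singleton_le_iff_mem]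
    obtain ⟨i, hi, j, hj, hij⟩ := Submodule.mem_sup.mp ((Ideal.eq_top_iff_one _).mp hcop)
    obtain ⟨c, rfl⟩ := Ideal.mem_span_singleton'.mp hj
    have : a = i * a + a * (c * s) := by linear_combination -a * hij
    have hmem := add_mem (Ideal.mul_mem_mul hi (Ideal.subset_span (by simp : a ∈ ({s, a} : Set O))))
      (Ideal.mul_mem_mul (self_mem_primaryPart p a) (Ideal.mul_mem_left _ c
        (Ideal.subset_span (by simp : s ∈ ({s, a} : Set O)))))
    rwa [← this] at hmem

end Primary

/-! ### Invertible ideals concentrated at `p`, and the kernel of `ord_p` -/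

section Local

variable {O : Type*} [CommRing O] [IsDomain O] {K : Type*} [Field K] [Algebra O K]
  [IsFractionRing O K]

theorem mem_localIdeal_of_mem (p : MaximalSpectrum O) {I : FractionalIdeal O⁰ K} {x : K}
    (hx : x ∈ I) : x ∈ localIdeal p I :=
  Submodule.subset_span hx

variable [IsNoetherianRing O] [Ring.KrullDimLE 1 O]

/-- For `a ≠ 0` there is an invertible ideal equal to `a O_p` at `p` and trivial elsewhere. -/
theorem exists_localIdeal_eq_span (p : MaximalSpectrum O) {a : O} (ha : a ≠ 0) :
    ∃ I : (FractionalIdeal O⁰ K)ˣ,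
      localIdeal p (I : FractionalIdeal O⁰ K) =
        Submodule.span (localRing K p) {algebraMap O K a} ∧
      ∀ q ≠ p, localIdeal q (I : FractionalIdeal O⁰ K) =
        Submodule.span (localRing K q) {(1 : K)} := by
  obtain ⟨J, hJ⟩ := exists_primaryPart_mul_eq p ha
  have ha' : algebraMap O K a ≠ 0 := by simpa using ha
  have hmul : (primaryPart p a : FractionalIdeal O⁰ K) *
      ((J : FractionalIdeal O⁰ K) *
        FractionalIdeal.spanSingleton O⁰ (algebraMap O K a)⁻¹) = 1 := by
    rw [← mul_assoc, ← FractionalIdeal.coeIdeal_mul, hJ,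
      FractionalIdeal.coeIdeal_span_singleton, FractionalIdeal.spanSingleton_mul_spanSingleton,
      mul_inv_cancel₀ ha', FractionalIdeal.spanSingleton_one]
  refine ⟨Units.mkOfMulEqOne _ _ hmul, ?_, fun q hq => ?_⟩
  · rw [Units.val_mkOfMulEqOne]
    refine le_antisymm (Submodule.span_le.mpr fun x hx => ?_) ?_
    · obtain ⟨y, ⟨s, hs, c, hc⟩, rfl⟩ := (FractionalIdeal.mem_coeIdeal _).mp hx
      refine Submodule.mem_span_singleton.mpr
        ⟨algebraMap O (localRing K p) c * ⟨_, inv_mem_localRing p hs⟩, ?_⟩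
      have hs0 : algebraMap O K s ≠ 0 := by
        have : s ≠ 0 := fun h => hs (h ▸ p.asIdeal.zero_mem)
        simpa using this
      change (algebraMap O K c * (algebraMap O K s)⁻¹) * algebraMap O K a = algebraMap O K y
      have := congrArg (algebraMap O K) hc
      rw [map_mul, map_mul] at this
      field_simp
      linear_combination -this
    · rw [Submodule.span_singleton_le_iff_mem]
      exact mem_localIdeal_of_mem p
        ((FractionalIdeal.mem_coeIdeal _).mpr ⟨a, self_mem_primaryPart p a, rfl⟩)
  · rw [Units.val_mkOfMulEqOne]
    -- Away from `p` the ideal contains some `t` outside `q`, which is invertible in `O_q`.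
    obtain ⟨t, ht, htq⟩ := SetLike.not_le_iff_exists.mp
      (fun h => hq (eq_of_primaryPart_le (q := q) ha h))
    refine le_antisymm (Submodule.span_le.mpr fun x hx => ?_) ?_
    · obtain ⟨y, _, rfl⟩ := (FractionalIdeal.mem_coeIdeal _).mp hx
      refine Submodule.mem_span_singleton.mpr ⟨algebraMap O (localRing K q) y, ?_⟩
      change algebraMap O K y * 1 = _
      rw [mul_one]
    · rw [Submodule.span_singleton_le_iff_mem]
      have h := Submodule.smul_mem (localIdeal q (primaryPart p a : FractionalIdeal O⁰ K))
        (⟨_, inv_mem_localRing q htq⟩ : localRing K q)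
        (mem_localIdeal_of_mem q ((FractionalIdeal.mem_coeIdeal _).mpr ⟨t, ht, rfl⟩))
      have ht0 : algebraMap O K t ≠ 0 := by
        have : t ≠ 0 := fun h => htq (h ▸ q.asIdeal.zero_mem)
        simpa using this
      have h1 : (⟨_, inv_mem_localRing q htq⟩ : localRing K q) • algebraMap O K t = 1 :=
        inv_mul_cancel₀ ht0
      rwa [h1] at h

theorem divisorHom_eq_iff (I J : (FractionalIdeal O⁰ K)ˣ) :
    divisorHom O K I = divisorHom O K J ↔ ∀ p, ordIdeal p I = ordIdeal p J := by
  refine ⟨fun h p => ?_, fun h => ?_⟩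
  · exact DFunLike.congr_fun (congrArg Multiplicative.toAdd h) p
  · exact congrArg Multiplicative.ofAdd (Finsupp.ext h)

/-- If `div` is injective, elements of `K` of order zero at `p` are units of `O_p`. -/
theorem exists_unit_of_ordAt_eq_one (hinj : Function.Injective (divisorHom O K))
    (p : MaximalSpectrum O) (x : Kˣ) (hx : ordAt K p x = 1) :
    ∃ u : (localRing K p)ˣ, algebraMap (localRing K p) K u = x := by
  obtain ⟨a, b, hb, hab⟩ := IsFractionRing.div_surjective (A := O) (x : K)
  have hb0 : b ≠ 0 := nonZeroDivisors.ne_zero hb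
  have ha0 : a ≠ 0 := by
    rintro rfl
    exact x.ne_zero (by rw [← hab, map_zero, zero_div])
  have ha' : algebraMap O K a ≠ 0 := by simpa using ha0
  have hb' : algebraMap O K b ≠ 0 := by simpa using hb0
  obtain ⟨I, hI, hI'⟩ := exists_localIdeal_eq_span (K := K) p ha0
  obtain ⟨J, hJ, hJ'⟩ := exists_localIdeal_eq_span (K := K) p hb0
  have hxab : Units.mk0 _ ha' = x * Units.mk0 _ hb' := by
    ext
    rw [Units.val_mul, Units.val_mk0, Units.val_mk0, ← hab, div_mul_cancel₀ _ hb']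
  have hIJ : I = J := hinj <| (divisorHom_eq_iff I J).mpr fun q => by
    by_cases hq : q = p
    · subst hq
      rw [ordIdeal_eq q I (Units.mk0 _ ha') hI, ordIdeal_eq q J (Units.mk0 _ hb') hJ, hxab,
        map_mul, hx, one_mul]
    · rw [ordIdeal_eq q I 1 (hI' q hq), ordIdeal_eq q J 1 (hJ' q hq)]
  rw [hIJ, hJ] at hI
  obtain ⟨u, hu⟩ := Submodule.span_singleton_eq_span_singleton.mp hI
  refine ⟨u, ?_⟩
  have hu' : algebraMap (localRing K p) K u * algebraMap O K b = algebraMap O K a := hu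
  rw [← hab, eq_div_iff hb', hu']

end Local

/-! ### The two implications -/

section Local

variable {O : Type*} [CommRing O] [IsDomain O] {K : Type*} [Field K] [Algebra O K]
  [IsFractionRing O K]

theorem asIdeal_ne_bot (hdim : ringKrullDim O = 1) (p : MaximalSpectrum O) : p.asIdeal ≠ ⊥ := by
  intro h
  have hp : (⊥ : Ideal O).IsMaximal := h ▸ p.isMaximal
  have := ringKrullDim_eq_zero_of_isField (Ring.isField_iff_maximal_bot.mpr hp)
  rw [hdim] at this
  exact one_ne_zero this

/-- Holds because `O` is the intersection of its localizations inside `K`. -/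
theorem le_one_of_forall_localIdeal_eq_one (I : FractionalIdeal O⁰ K)
    (h : ∀ p, localIdeal p I = 1) : I ≤ 1 := by
  intro x hx
  have hmem : x ∈ (⨅ p : MaximalSpectrum O, localRing K p) := by
    rw [Algebra.mem_iInf]
    intro p
    have hxp := mem_localIdeal_of_mem p hx
    rw [h p] at hxp
    obtain ⟨r, hr⟩ := Submodule.mem_one.mp hxp
    exact hr ▸ r.2
  rw [MaximalSpectrum.iInf_localization_eq_bot O K] at hmem
  exact (FractionalIdeal.mem_one_iff _).mpr (Algebra.mem_bot.mp hmem)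

variable [IsNoetherianRing O] [Ring.KrullDimLE 1 O]

theorem isDedekindDomain_of_integralClosure_eq_bot (h : integralClosure O K = ⊥) :
    IsDedekindDomain O := by
  have hdim : Ring.DimensionLEOne O := ⟨fun h0 hp => hp.isMaximal_of_ne_bot h0⟩
  have : IsDedekindRing O := (isDedekindRing_iff O K).mpr
    ⟨inferInstance, hdim, fun {x} hx => Algebra.mem_bot.mp (h ▸ hx)⟩
  exact { }

/-- Order zero yields a unit once the element is known to lie in `O_p`; in a valuation ring the
generator or its inverse does. -/
theorem localIdeal_eq_one_of_ordIdeal_eq_zero (p : MaximalSpectrum O)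
    [ValuationRing (localRing K p)]
    (I : (FractionalIdeal O⁰ K)ˣ) (h : ordIdeal p I = 0) :
    localIdeal p (I : FractionalIdeal O⁰ K) = 1 := by
  obtain ⟨x, hx⟩ := exists_localIdeal_eq p I
  rw [ordIdeal_eq p I x hx] at h
  have h1 : ordAt K p x = 1 := h
  have key : ∃ u : (localRing K p)ˣ, algebraMap (localRing K p) K u = x := by
    rcases ValuationRing.isInteger_or_isInteger (localRing K p) (x : K) with ⟨r, hr⟩ | ⟨r, hr⟩
    · obtain ⟨u, rfl⟩ := isUnit_of_ordAt_eq_one p x r hr.symm h1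
      exact ⟨u, hr⟩
    · obtain ⟨u, rfl⟩ := isUnit_of_ordAt_eq_one p x⁻¹ r
        ((Units.val_inv_eq_inv_val x).trans hr.symm) (by rw [map_inv, h1, inv_one])
      refine ⟨u⁻¹, ?_⟩
      rw [map_units_inv, hr, inv_inv]
  obtain ⟨u, hu⟩ := key
  rw [hx, Submodule.one_eq_span]
  refine Submodule.span_singleton_eq_span_singleton.mpr ⟨u⁻¹, ?_⟩
  change algebraMap (localRing K p) K ↑u⁻¹ * (x : K) = 1
  rw [← hu, ← map_mul, Units.inv_mul, map_one]

theorem divisorHom_injective_of_integralClosure_eq_bot (hdim : ringKrullDim O = 1)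
    (h : integralClosure O K = ⊥) : Function.Injective (divisorHom O K) := by
  have := isDedekindDomain_of_integralClosure_eq_bot h
  have hle : ∀ I, divisorHom O K I = 1 → (I : FractionalIdeal O⁰ K) ≤ 1 := by
    intro I hI
    refine le_one_of_forall_localIdeal_eq_one _ fun p => ?_
    have := IsLocalization.AtPrime.isDiscreteValuationRing_of_dedekind_domain O
      (asIdeal_ne_bot hdim p) (localRing K p)
    refine localIdeal_eq_one_of_ordIdeal_eq_zero p I ?_
    rw [← map_one (divisorHom O K), divisorHom_eq_iff] at hI
    rw [hI p, ordIdeal_one]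
  rw [injective_iff_map_eq_one]
  intro I hI
  -- The reverse inclusion comes from `I⁻¹ ≤ 1`, since `I⁻¹` also has trivial divisor.
  refine Units.ext (le_antisymm (hle I hI) ?_)
  have hinv := hle I⁻¹ (by rw [map_inv, hI, inv_one])
  calc (1 : FractionalIdeal O⁰ K) = I * ((I⁻¹ : (FractionalIdeal O⁰ K)ˣ) : _) := I.mul_inv.symm
    _ ≤ I * 1 := mul_le_mul_right hinv _
    _ = I := mul_one _

theorem integralClosure_eq_bot_of_divisorHom_injective (hdim : ringKrullDim O = 1)
    (hinj : Function.Injective (divisorHom O K)) : integralClosure O K = ⊥ := by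
  rw [eq_bot_iff, ← MaximalSpectrum.iInf_localization_eq_bot O K]
  intro x hx
  rw [Algebra.mem_iInf]
  intro p
  -- Dimension one supplies a nonzero `a` in `p`: a nonzero nonunit of `O_p`, so that `O_p` is not a
  -- field.
  obtain ⟨a, hap, ha0⟩ := Submodule.exists_mem_ne_zero_of_ne_bot (asIdeal_ne_bot hdim p)
  have hau : ¬ IsUnit (algebraMap O (localRing K p) a) := by
    rw [IsLocalization.AtPrime.isUnit_to_map_iff (localRing K p) p.asIdeal]
    exact fun h => h hap
  have ha0' : algebraMap O (localRing K p) a ≠ 0 := fun h0 => ha0 <|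
    IsFractionRing.injective O K <| by
      rw [map_zero]
      exact congrArg Subtype.val h0
  have hx' : IsIntegral (localRing K p) x := IsIntegral.tower_top (R := O) hx
  obtain ⟨r, hr⟩ := mem_range_of_isIntegral_of_ker_le (ordAt K p)
    (exists_unit_of_ordAt_eq_one hinj p) hau ha0' hx'
  exact hr ▸ r.2

end Local

end OrderDiv

theorem theorem5p4 {O : Type*} [CommRing O] [IsDomain O] [IsNoetherianRing O]
    [Ring.KrullDimLE 1 O] (hdim : ringKrullDim O = 1)
    {K : Type*} [Field K] [Algebra O K] [IsFractionRing O K]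
    (hfin : Module.Finite O (integralClosure O K)) :
    Function.Injective (OrderDiv.divisorHom O K) ↔ integralClosure O K = ⊥ :=
  ⟨OrderDiv.integralClosure_eq_bot_of_divisorHom_injective hdim,
    OrderDiv.divisorHom_injective_of_integralClosure_eq_bot hdim⟩
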